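/- Let $g$ be the round metric on the unit sphere $S^n\subset\mathbb R^{n+1}$, with Levi-Civita connection $\nabla$ and curvature tensor $R(X,Y)Z=\nabla_Y\nabla_XZ-\nabla_X\nabla_YZ+\nabla_{[X,Y]}Z$. Let $\Sigma\subset S^n$ be a closed (compact, without boundary) smooth embedded $k$-dimensional submanifold, not necessarily minimal, with second fundamental form $A(X,Y)=(\nabla_XY)^\perp$, where $\perp$ denotes the component normal to $\Sigma$ in $S^n$, and with normal connection $\nabla^\perp_XV=(\nabla_XV)^\perp$. For a normal vector field $V$ along $\Sigma$ put, at each point of $\Sigma$, $$q^\Sigma(V,V)=\sum_{i=1}^k|\nabla^\perp_{E_i}V|_g^2-\sum_{i=1}^k g(R(V,E_i)V,E_i)-\sum_{i,j=1}^k g(A(E_i,E_j),V)^2,\qquad Q^\Sigma(V,V)=\int_\Sigma q^\Sigma(V,V)\,dg,$$ where $E_1,\dots,E_k$ is an orthonormal basis of the tangent space of $\Sigma$ at the point and $dg$ is the Riemannian volume measure of $\Sigma$. Let $v_1,\dots,v_{n+1}$ be any orthonormal basis of $\mathbb R^{n+1}$, and let $V_\alpha$ be the gradient on $S^n$ of the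 function $x\mapsto\langle v_\alpha,x\rangle$, that is, the projection to $S^n$ of the constant vector field $v_\alpha$. Then at every point of $\Sigma$ $$\operatorname{tr}_{\mathcal V}q^\Sigma:=\sum_{\alpha=1}^{n+1}q^\Sigma(V_\alpha^\perp,V_\alpha^\perp)=-k(n-k).$$ Moreover $\Sigma$ has finite volume, each function $q^\Sigma(V_\alpha^\perp,V_\alpha^\perp)$ is integrable on $\Sigma$, and $$\operatorname{tr}_{\mathcal V}Q^\Sigma:=\sum_{\alpha=1}^{n+1}Q^\Sigma(V_\alpha^\perp,V_\alpha^\perp)=\int_\Sigma\operatorname{tr}_{\mathcal V}q^\Sigma\,dg=-k(n-k)\operatorname{vol}_g(\Sigma).$$ -/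

import Mathlib

open scoped ContDiff MeasureTheory

noncomputable section

/-! Riemannian geometry of smooth embedded submanifolds of a Euclidean space `E`, with the
induced metrics. A vector field (along a set `S`) is represented by a function `E → E`; all
definitions below only use its values on `S`. -/

namespace SubmanifoldGeometry

/-- `S` is a smooth (that is, `C^∞`) embedded `k`-dimensional submanifold, without boundary, of
the Euclidean space `E`: around each of its points there is a smooth local diffeomorphism `Φ` of
`E` that flattens `S` to a `k`-dimensional linear subspace (slice chart). -/
def IsEmbeddedSubmanifold {E : Type*} [NormedAddCommGroup E] [InnerProductSpace ℝ E]
    (k : ℕ) (S : Set E) : Prop :=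
  ∀ p ∈ S, ∃ (Φ : OpenPartialHomeomorph E E) (K : Submodule ℝ E),
    Module.finrank ℝ K = k ∧ p ∈ Φ.source ∧
    ContDiffOn ℝ ∞ Φ Φ.source ∧ ContDiffOn ℝ ∞ Φ.symm Φ.target ∧
    ∀ x ∈ Φ.source, x ∈ S ↔ Φ x ∈ K

/-- `S` is a closed (that is, compact and without boundary) smooth embedded `k`-dimensional
submanifold of `M`, where `M` is itself an embedded submanifold of `E`. -/
structure IsClosedSubmanifold {E : Type*} [NormedAddCommGroup E] [InnerProductSpace ℝ E]
    (k : ℕ) (S M : Set E) : Prop where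
  subset : S ⊆ M
  isCompact : IsCompact S
  isEmbeddedSubmanifold : IsEmbeddedSubmanifold k S

/-- The tangent space `T_p S`, as a linear subspace of `E`: it consists of the limits of rescaled
secants `c_n • (x_n - p)` with `x_n ∈ S`, `x_n → p` (the span is only there to have a linear
subspace by construction). -/
def tangentSpace {E : Type*} [NormedAddCommGroup E] [InnerProductSpace ℝ E]
    (S : Set E) (p : E) : Submodule ℝ E :=
  Submodule.span ℝ (tangentConeAt ℝ S p)

/-- The orthogonal projection of `E` onto `T_p S`. -/
def tangentProj {E : Type*} [NormedAddCommGroup E] [InnerProductSpace ℝ E]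
    [FiniteDimensional ℝ E] (S : Set E) (p : E) : E →L[ℝ] E :=
  (tangentSpace S p).starProjection

/-- The normal space `N_p S` of `S` in `M`: the orthogonal complement of `T_p S` in `T_p M`. -/
def normalSpace {E : Type*} [NormedAddCommGroup E] [InnerProductSpace ℝ E]
    (M S : Set E) (p : E) : Submodule ℝ E :=
  tangentSpace M p ⊓ (tangentSpace S p)ᗮ

/-- The orthogonal projection onto `N_p S`. For `v ∈ T_p M` it is the normal component `v^⊥`. -/
def normalProj {E : Type*} [NormedAddCommGroup E] [InnerProductSpace ℝ E]
    [FiniteDimensional ℝ E] (M S : Set E) (p : E) : E →L[ℝ] E :=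
  (normalSpace M S p).starProjection

/-- The normal component `X^⊥` of a vector field `X` of `M` along `S`. -/
def normalPart {E : Type*} [NormedAddCommGroup E] [InnerProductSpace ℝ E]
    [FiniteDimensional ℝ E] (M S : Set E) (X : E → E) : E → E :=
  fun p => normalProj M S p (X p)

/-- `∇_x V` at `p`, for `x ∈ T_p S` and a vector field `V` of `M` along `S ⊆ M`, where `∇` is the
Levi-Civita connection of `M` with the metric induced by `E`: the component tangent to `M` of the
directional derivative of `V`. The derivative is taken along `S`; its value at a vector tangent to
`S` is determined by the values of `V` on `S`. With `S = M` this is the covariant derivative of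
vector fields on `M`. -/
def covDeriv {E : Type*} [NormedAddCommGroup E] [InnerProductSpace ℝ E]
    [FiniteDimensional ℝ E] (M S : Set E) (V : E → E) (p x : E) : E :=
  tangentProj M p (fderivWithin ℝ V S p x)

/-- The normal connection `∇^⊥_x V = (∇_x V)^⊥` of `S` in `M`. -/
def normalCovDeriv {E : Type*} [NormedAddCommGroup E] [InnerProductSpace ℝ E]
    [FiniteDimensional ℝ E] (M S : Set E) (V : E → E) (p x : E) : E :=
  normalProj M S p (covDeriv M S V p x)

/-- The canonical extension of a tangent vector `y ∈ T_p S` to a smooth tangent vector field on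
`S`, namely `q ↦` the orthogonal projection of `y` onto `T_q S`. It is only used to evaluate
tensorial expressions in vector fields at tangent vectors. -/
def tangentExt {E : Type*} [NormedAddCommGroup E] [InnerProductSpace ℝ E]
    [FiniteDimensional ℝ E] (S : Set E) (y : E) : E → E :=
  fun q => tangentProj S q y

/-- The second fundamental form `A(x, y) = (∇_x Y)^⊥` of `S` in `M` at `p`, for `x, y ∈ T_p S` and
`Y` a tangent vector field of `S` that extends `y` (the result does not depend on the extension,
see `normalCovDeriv_eq_secondFundamentalForm`). -/
def secondFundamentalForm {E : Type*} [NormedAddCommGroup E] [InnerProductSpace ℝ E]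
    [FiniteDimensional ℝ E] (M S : Set E) (p x y : E) : E :=
  normalCovDeriv M S (tangentExt S y) p x

/-- The derivative along `S` is unambiguous at vectors tangent to `S`. -/
lemma fderivWithin_eq_of_mem {E F : Type*} [NormedAddCommGroup E] [InnerProductSpace ℝ E]
    [NormedAddCommGroup F] [NormedSpace ℝ F]
    {S : Set E} {p x : E} {f : E → F} {f' : E →L[ℝ] F} (h : HasFDerivWithinAt f f' S p)
    (hx : x ∈ tangentSpace S p) : fderivWithin ℝ f S p x = f' x := by
  have h2 := h.differentiableWithinAt.hasFDerivWithinAt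
  have := h2.unique_on h
  have hle : tangentSpace S p ≤ LinearMap.eqLocus
        (fderivWithin ℝ f S p : E →ₗ[ℝ] F) (f' : E →ₗ[ℝ] F) := by
    rw [tangentSpace, Submodule.span_le]
    intro y hy
    exact this hy
  exact hle hx

lemma tangentProj_mem {E : Type*} [NormedAddCommGroup E] [InnerProductSpace ℝ E]
    [FiniteDimensional ℝ E] {S : Set E} {p x : E} : tangentProj S p x ∈ tangentSpace S p := by
  simp [tangentProj]

lemma tangentProj_eq {E : Type*} [NormedAddCommGroup E] [InnerProductSpace ℝ E]
    [FiniteDimensional ℝ E] {S : Set E} {p x : E} (hx : x ∈ tangentSpace S p) :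
    tangentProj S p x = x := by
  rw [tangentProj, Submodule.starProjection_eq_self_iff]; exact hx

/-- `(∇_x Y)^⊥ = A(x, Y(p))` for every tangent vector field `Y` of `S`: the second fundamental form
does not depend on how the tangent vector `Y(p)` is extended. -/
theorem normalCovDeriv_eq_secondFundamentalForm {E : Type*} [NormedAddCommGroup E] [InnerProductSpace ℝ E]
    [FiniteDimensional ℝ E] {M S : Set E} (hSM : S ⊆ M) {p x : E} {Y : E → E} (hp : p ∈ S)
    (hP : DifferentiableWithinAt ℝ (tangentProj S) S p)
    (hY : DifferentiableWithinAt ℝ Y S p) (hYt : ∀ q ∈ S, Y q ∈ tangentSpace S q)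
    (hx : x ∈ tangentSpace S p) :
    normalCovDeriv M S Y p x = secondFundamentalForm M S p x (Y p) := by
  have key : HasFDerivWithinAt Y _ S p :=
    ((hP.hasFDerivWithinAt.clm_apply hY.hasFDerivWithinAt).congr
      (fun q hq => (tangentProj_eq (hYt q hq)).symm) (tangentProj_eq (hYt p hp)).symm)
  have k2 : HasFDerivWithinAt (tangentExt S (Y p)) _ S p :=
    hP.hasFDerivWithinAt.clm_apply (hasFDerivWithinAt_const (Y p) p S)
  have hperp : ∀ w ∈ tangentSpace S p, normalProj M S p (tangentProj M p w) = 0 := by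
    intro w hw
    have : tangentSpace S p ≤ tangentSpace M p := Submodule.span_mono (tangentConeAt_mono hSM)
    rw [tangentProj_eq (this hw), normalProj, Submodule.starProjection_apply_eq_zero_iff]
    rw [Submodule.mem_orthogonal]
    intro u hu
    have := hu.2
    rw [SetLike.mem_coe, Submodule.mem_orthogonal] at this
    rw [real_inner_comm]; exact this w hw
  simp only [secondFundamentalForm, normalCovDeriv, covDeriv]
  rw [fderivWithin_eq_of_mem key hx, fderivWithin_eq_of_mem k2 hx]
  simp [hperp _ tangentProj_mem]

/-- The Riemann curvature of `M` on vector fields, with the sign convention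
`R(X, Y) Z = ∇_Y ∇_X Z - ∇_X ∇_Y Z + ∇_[X, Y] Z`. -/
def curvatureField {E : Type*} [NormedAddCommGroup E] [InnerProductSpace ℝ E]
    [FiniteDimensional ℝ E] (M : Set E) (X Y Z : E → E) (p : E) : E :=
  covDeriv M M (fun q => covDeriv M M Z q (X q)) p (Y p)
    - covDeriv M M (fun q => covDeriv M M Z q (Y q)) p (X p)
    + covDeriv M M Z p (VectorField.lieBracketWithin ℝ X Y M p)

/-- The Riemann curvature tensor `R(x, y) z` of `M` at `p`, for `x, y, z ∈ T_p M`. -/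
def curvature {E : Type*} [NormedAddCommGroup E] [InnerProductSpace ℝ E]
    [FiniteDimensional ℝ E] (M : Set E) (p x y z : E) : E :=
  curvatureField M (tangentExt M x) (tangentExt M y) (tangentExt M z) p

/-- The Riemannian gradient on `M` of a function `h`: the vector of `T_p M` that represents the
differential `dh_p` on `T_p M`. -/
def grad {E : Type*} [NormedAddCommGroup E] [InnerProductSpace ℝ E]
    [FiniteDimensional ℝ E] (M : Set E) (h : E → ℝ) : E → E :=
  fun p => (InnerProductSpace.toDual ℝ E).symm ((fderivWithin ℝ h M p).comp (tangentProj M p))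

/-- The pointwise second variation quadratic form of `S` in `M` at a normal vector field `V`,
`q(V, V) = |∇^⊥_S V|² - tr_S g(R(V, ·) V, ·) - |g(A(·, ·), V)|²`,
computed in an orthonormal basis of `T_p S` (its value does not depend on the basis). -/
def secondVariationDensity {E : Type*} [NormedAddCommGroup E] [InnerProductSpace ℝ E]
    [FiniteDimensional ℝ E] (M S : Set E) (V : E → E) (p : E) : ℝ :=
  let e := stdOrthonormalBasis ℝ (tangentSpace S p)
  ∑ i, ‖normalCovDeriv M S V p (e i)‖ ^ 2
    - ∑ i, inner ℝ (curvature M p (V p) (e i) (V p)) (e i : E)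
    - ∑ i, ∑ j, (inner ℝ (secondFundamentalForm M S p (e i) (e j)) (V p)) ^ 2

/-- The Riemannian volume measure of the `k`-dimensional submanifold `S`, as a measure on `E`: the
`k`-dimensional Hausdorff measure (normalized so as to agree with Lebesgue measure on
`k`-dimensional Euclidean spaces), restricted to `S`. -/
def volumeMeasure {E : Type*} [NormedAddCommGroup E] [InnerProductSpace ℝ E]
    [MeasurableSpace E] [BorelSpace E] (k : ℕ) (S : Set E) : MeasureTheory.Measure E :=
  (μHE[k] : MeasureTheory.Measure E).restrict S

/-- The second variation quadratic form `Q(V, V) = ∫_S q(V, V)`. -/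
def secondVariation {E : Type*} [NormedAddCommGroup E] [InnerProductSpace ℝ E]
    [FiniteDimensional ℝ E] [MeasurableSpace E] [BorelSpace E]
    (k : ℕ) (M S : Set E) (V : E → E) : ℝ :=
  ∫ p, secondVariationDensity M S V p ∂(volumeMeasure k S)

/-- The round unit sphere `S^n` in `ℝ^{n+1}`. -/
def roundSphere (n : ℕ) : Set (EuclideanSpace ℝ (Fin (n + 1))) :=
  Metric.sphere 0 1

/-- The vector field on `S^n` induced by the constant vector `v` of `ℝ^{n+1}`, that is the
gradient on `S^n` of the restriction of the linear function `x ↦ ⟨v, x⟩`. -/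
def sphereField (n : ℕ) (v : EuclideanSpace ℝ (Fin (n + 1))) :
    EuclideanSpace ℝ (Fin (n + 1)) → EuclideanSpace ℝ (Fin (n + 1)) :=
  grad (roundSphere n) (fun x => inner ℝ v x)

/-- The pointwise trace `∑_α q(V_α^⊥, V_α^⊥)` for a submanifold `S` of `S^n`, where `V_α` is the
vector field on `S^n` induced by the constant vector `v α`. -/
def traceDensity (n : ℕ) (S : Set (EuclideanSpace ℝ (Fin (n + 1))))
    (v : Fin (n + 1) → EuclideanSpace ℝ (Fin (n + 1))) (p : EuclideanSpace ℝ (Fin (n + 1))) : ℝ :=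
  ∑ α, secondVariationDensity (roundSphere n) S
    (normalPart (roundSphere n) S (sphereField n (v α))) p

/-- The trace `∑_α Q(V_α^⊥, V_α^⊥)` for a `k`-dimensional submanifold `S` of `S^n`, where `V_α` is
the vector field on `S^n` induced by the constant vector `v α`. -/
def traceSecondVariation (n k : ℕ) (S : Set (EuclideanSpace ℝ (Fin (n + 1))))
    (v : Fin (n + 1) → EuclideanSpace ℝ (Fin (n + 1))) : ℝ :=
  ∑ α, secondVariation k (roundSphere n) S
    (normalPart (roundSphere n) S (sphereField n (v α)))

end SubmanifoldGeometry

end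

/-!
The pointwise identity rests on two facts about a submanifold `S` of the unit sphere of a Euclidean
space `E`. Write `P` and `N` for the orthogonal projections onto the tangent spaces and onto the
normal spaces of `S`, so that `N = id - ⟨p, ·⟩ p - P`, and `D_x P` for the derivative of `P` along
`S`. Differentiating `N v` for a constant vector `v` gives `∇^⊥_x (v^⊥) = -N (D_x P) v`, while
`A(x, y) = N (D_x P) y`. Differentiating `P² = P` gives `N (D_x P) P = N (D_x P)`, so that
`∇^⊥_x (v^⊥) = -A(x, v^T)` (`normalCovDeriv_normalPart_grad_sphere`,
`normalProj_fderivWithin_tangentProj`). By Parseval's identity, both the sum of `|∇^⊥ v_α^⊥|²` and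
the sum of `⟨A, v_α⟩²` over an orthonormal basis `v_α` are equal to `|A|²`, and they cancel. As the
sphere has curvature `1` (`curvature_sphere`), the curvature term contributes
`-k ∑ |v_α^⊥|² = -k (n - k)` (`sum_secondVariationDensity_sphere`).

The derivative of `P` exists since in a slice chart `T_q S` is the range of an injective operator
`B` that depends smoothly on `q`, and `P = B (B† B)⁻¹ B†`; this formula extends `P` to a `C¹`
function on a neighbourhood in `E` (`IsEmbeddedSubmanifold.exists_contDiffAt_tangentProj`). It also
shows that each second variation density is continuous along `S`
(`continuousOn_secondVariationDensity_sphere`). Slice charts exhibit `S` locally as a Lipschitz image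
of a bounded subset of a `k`-dimensional linear space, so a compact `S` has finite volume
(`volumeMeasure_univ_lt_top`). Hence the densities are integrable, and the integrated identity
follows from the pointwise one.
-/

namespace SubmanifoldGeometry

open scoped ContDiff MeasureTheory Topology RealInnerProductSpace
open Filter Set

variable {E F : Type*} [NormedAddCommGroup E] [InnerProductSpace ℝ E]
  [NormedAddCommGroup F] [InnerProductSpace ℝ F]

/-! ### Tangent spaces -/

lemma tangentSpace_mono {S T : Set E} (h : S ⊆ T) (p : E) : tangentSpace S p ≤ tangentSpace T p :=
  Submodule.span_mono (tangentConeAt_mono h)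

lemma tangentSpace_inter_nhds {S U : Set E} {p : E} (hU : U ∈ 𝓝 p) :
    tangentSpace (S ∩ U) p = tangentSpace S p := by
  rw [tangentSpace, tangentSpace, tangentConeAt_inter_nhds hU]

lemma tangentSpace_univ (p : E) : tangentSpace (univ : Set E) p = ⊤ := by
  rw [tangentSpace, tangentConeAt_univ, Submodule.span_univ]

/-- The derivative of a map that sends `S` into `T` sends tangent vectors of `S` to tangent
vectors of `T`. -/
lemma apply_mem_tangentSpace {S : Set E} {T : Set F} {p x : E} {f : E → F} {f' : E →L[ℝ] F}
    (hf : HasFDerivWithinAt f f' S p) (hST : MapsTo f S T) (hx : x ∈ tangentSpace S p) :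
    f' x ∈ tangentSpace T (f p) := by
  have hle : tangentSpace S p ≤ (tangentSpace T (f p)).comap (f' : E →ₗ[ℝ] F) := by
    rw [tangentSpace, Submodule.span_le]
    intro y hy
    exact Submodule.subset_span (tangentConeAt_mono hST.image_subset (hf.mapsTo_tangent_cone hy))
  exact hle hx

/-- If `f` vanishes on `S`, then its derivative vanishes on the tangent vectors of `S`. -/
lemma apply_eq_zero_of_mem_tangentSpace {G : Type*} [NormedAddCommGroup G] [NormedSpace ℝ G]
    {S : Set E} {p x : E} {f : E → G} {f' : E →L[ℝ] G}
    (hf : HasFDerivWithinAt f f' S p) (h : ∀ q ∈ S, f q = 0) (hp : p ∈ S)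
    (hx : x ∈ tangentSpace S p) : f' x = 0 := by
  rw [← fderivWithin_eq_of_mem hf hx]
  exact fderivWithin_eq_of_mem (f' := 0)
    ((hasFDerivWithinAt_const (0 : G) p S).congr h (h p hp)) hx

lemma tangentSpace_coe_submodule (K : Submodule ℝ E) [FiniteDimensional ℝ K] {q : E} (hq : q ∈ K) :
    tangentSpace (K : Set E) q = K := by
  apply le_antisymm
  · intro x hx
    have h := apply_eq_zero_of_mem_tangentSpace (f := Kᗮ.starProjection) (S := (K : Set E))
      Kᗮ.starProjection.hasFDerivWithinAt (fun q hq => by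
        rw [Submodule.starProjection_apply_eq_zero_iff]
        exact Submodule.le_orthogonal_orthogonal K hq) hq hx
    rw [Submodule.starProjection_apply_eq_zero_iff, Submodule.orthogonal_orthogonal] at h
    exact h
  · intro x hx
    have hd : HasFDerivWithinAt (fun y : K => (y : E)) K.subtypeL univ ⟨q, hq⟩ :=
      K.subtypeL.hasFDerivWithinAt
    have hu : (⟨x, hx⟩ : K) ∈ tangentSpace (univ : Set K) ⟨q, hq⟩ := by
      rw [tangentSpace_univ]; exact Submodule.mem_top
    exact apply_mem_tangentSpace (T := (K : Set E)) hd (fun y _ => y.2) hu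

/-- In a slice chart `Φ` of `S`, the tangent space of `S` at `q` is the image of the model
subspace under the derivative of `Φ⁻¹`, and this derivative is injective. -/
lemma tangentSpace_eq_map_of_chart {S : Set E} {Φ : OpenPartialHomeomorph E E}
    {K : Submodule ℝ E} [FiniteDimensional ℝ K]
    (h1 : ContDiffOn ℝ ∞ Φ Φ.source) (h2 : ContDiffOn ℝ ∞ Φ.symm Φ.target)
    (hK : ∀ x ∈ Φ.source, x ∈ S ↔ Φ x ∈ K) {q : E} (hq : q ∈ Φ.source) (hqS : q ∈ S) :
    tangentSpace S q = K.map (fderiv ℝ Φ.symm (Φ q) : E →ₗ[ℝ] E) ∧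
      Function.Injective (fderiv ℝ Φ.symm (Φ q)) := by
  have hq' : Φ q ∈ Φ.target := Φ.map_source hq
  have d1 : HasFDerivAt Φ (fderiv ℝ Φ q) q :=
    ((h1.contDiffAt (Φ.open_source.mem_nhds hq)).differentiableAt (by simp)).hasFDerivAt
  have d2 : HasFDerivAt Φ.symm (fderiv ℝ Φ.symm (Φ q)) (Φ q) :=
    ((h2.contDiffAt (Φ.open_target.mem_nhds hq')).differentiableAt (by simp)).hasFDerivAt
  have c1 : ∀ x, fderiv ℝ Φ.symm (Φ q) (fderiv ℝ Φ q x) = x := by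
    intro x
    have e := (d2.comp q d1).unique ((hasFDerivAt_id q).congr_of_eventuallyEq
      (Φ.eventually_left_inverse hq))
    exact DFunLike.congr_fun e x
  have c2 : ∀ x, fderiv ℝ Φ q (fderiv ℝ Φ.symm (Φ q) x) = x := by
    intro x
    have d1' : HasFDerivAt Φ (fderiv ℝ Φ q) (Φ.symm (Φ q)) := by rwa [Φ.left_inv hq]
    have e := (d1'.comp (Φ q) d2).unique ((hasFDerivAt_id (Φ q)).congr_of_eventuallyEq
      (Φ.eventually_right_inverse hq'))
    exact DFunLike.congr_fun e x
  refine ⟨le_antisymm (fun x hx => ?_) ?_, Function.LeftInverse.injective c2⟩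
  · refine ⟨fderiv ℝ Φ q x, ?_, c1 x⟩
    rw [← tangentSpace_inter_nhds (Φ.open_source.mem_nhds hq)] at hx
    have := apply_mem_tangentSpace (T := (K : Set E)) d1.hasFDerivWithinAt
      (fun y hy => (hK y hy.2).1 hy.1) hx
    rwa [tangentSpace_coe_submodule K ((hK q hq).1 hqS)] at this
  · rintro _ ⟨y, hy, rfl⟩
    have hy' : y ∈ tangentSpace ((K : Set E) ∩ Φ.target) (Φ q) := by
      rw [tangentSpace_inter_nhds (Φ.open_target.mem_nhds hq'),
        tangentSpace_coe_submodule K ((hK q hq).1 hqS)]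
      exact hy
    have := apply_mem_tangentSpace (T := S) d2.hasFDerivWithinAt (fun z hz => by
      rw [hK _ (Φ.map_target hz.2), Φ.right_inv hz.2]; exact hz.1) hy'
    rwa [Φ.left_inv hq] at this

/-! ### Smoothness of the tangential projection -/

variable [FiniteDimensional ℝ E] [FiniteDimensional ℝ F]

/-- If `A` is injective then `A† A` is invertible. -/
lemma isUnit_adjoint_comp_self {A : F →L[ℝ] E} (hA : Function.Injective A) :
    IsUnit (A.adjoint ∘L A : F →L[ℝ] F) := by
  have hinj : Function.Injective (A.adjoint ∘L A : F →L[ℝ] F) := by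
    rw [injective_iff_map_eq_zero]
    intro x hx
    have h0 : ⟪A x, A x⟫ = 0 := by
      rw [← ContinuousLinearMap.adjoint_inner_left]
      rw [ContinuousLinearMap.comp_apply] at hx
      rw [hx, inner_zero_left]
    exact (injective_iff_map_eq_zero A).1 hA x (inner_self_eq_zero.1 h0)
  rw [ContinuousLinearMap.isUnit_iff_bijective]
  exact ⟨hinj, (LinearMap.injective_iff_surjective
    (f := ((A.adjoint ∘L A : F →L[ℝ] F) : F →ₗ[ℝ] F))).1 hinj⟩

/-- The orthogonal projection onto the range of an injective `A` is `A (A† A)⁻¹ A†`. -/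
lemma starProjection_range_eq {A : F →L[ℝ] E} (hA : Function.Injective A) :
    (LinearMap.range (A : F →ₗ[ℝ] E)).starProjection =
      A ∘L Ring.inverse (A.adjoint ∘L A : F →L[ℝ] F) ∘L A.adjoint := by
  ext x
  apply Submodule.eq_starProjection_of_mem_of_inner_eq_zero
  · exact ⟨_, rfl⟩
  · rintro _ ⟨y, rfl⟩
    have h := DFunLike.congr_fun (Ring.mul_inverse_cancel _ (isUnit_adjoint_comp_self hA))
      (A.adjoint x)
    simp only [mul_apply_eq_comp, ContinuousLinearMap.comp_apply,
      one_apply_eq_self] at h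
    rw [ContinuousLinearMap.coe_coe, ← ContinuousLinearMap.adjoint_inner_left, map_sub]
    simp [ContinuousLinearMap.comp_apply, h]

lemma contDiff_adjoint {m : WithTop ℕ∞} :
    ContDiff ℝ m (fun A : F →L[ℝ] E => A.adjoint) := by
  let L : (F →L[ℝ] E) →ₗ[ℝ] (E →L[ℝ] F) :=
    { toFun := fun A => A.adjoint
      map_add' := fun A B => map_add _ A B
      map_smul' := fun c A => by simp }
  exact L.toContinuousLinearMap.contDiff

/-- The projection onto the range of an injective operator depends smoothly on the operator. -/
lemma contDiffAt_adjoint_formula {A : F →L[ℝ] E} (hA : Function.Injective A) {m : WithTop ℕ∞} :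
    ContDiffAt ℝ m (fun B : F →L[ℝ] E =>
      B ∘L Ring.inverse (B.adjoint ∘L B : F →L[ℝ] F) ∘L B.adjoint) A := by
  have h1 : ContDiffAt ℝ m (fun B : F →L[ℝ] E => (B.adjoint ∘L B : F →L[ℝ] F)) A :=
    contDiff_adjoint.contDiffAt.clm_comp contDiffAt_id
  obtain ⟨u, hu⟩ := isUnit_adjoint_comp_self hA
  have h2 : ContDiffAt ℝ m Ring.inverse (A.adjoint ∘L A : F →L[ℝ] F) :=
    hu ▸ contDiffAt_ringInverse ℝ u
  exact contDiffAt_id.clm_comp ((ContDiffAt.comp (g := Ring.inverse)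
    (f := fun B : F →L[ℝ] E => (B.adjoint ∘L B : F →L[ℝ] F)) A h2 h1).clm_comp
      contDiff_adjoint.contDiffAt)

/-- Near each of its points, the field of orthogonal projections onto the tangent spaces of an
embedded submanifold extends to a `C¹` function on the ambient space. -/
lemma IsEmbeddedSubmanifold.exists_contDiffAt_tangentProj {k : ℕ} {S : Set E}
    (hS : IsEmbeddedSubmanifold k S) {p : E} (hp : p ∈ S) :
    ∃ Q : E → E →L[ℝ] E, ContDiffAt ℝ 1 Q p ∧ ∀ᶠ q in 𝓝[S] p, tangentProj S q = Q q := by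
  obtain ⟨Φ, K, -, hps, h1, h2, hK⟩ := hS p hp
  have hpt : Φ p ∈ Φ.target := Φ.map_source hps
  let A : E → (K →L[ℝ] E) := fun q => fderiv ℝ Φ.symm (Φ q) ∘L K.subtypeL
  have hA : ContDiffAt ℝ 1 A p := by
    have a1 : ContDiffAt ℝ 1 (fderiv ℝ Φ.symm) (Φ p) :=
      (h2.contDiffAt (Φ.open_target.mem_nhds hpt)).fderiv_right (by norm_cast)
    have a2 : ContDiffAt ℝ 1 Φ p :=
      (h1.contDiffAt (Φ.open_source.mem_nhds hps)).of_le (by norm_cast)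
    exact (a1.comp p a2).clm_comp contDiffAt_const
  have hinj : ∀ q ∈ Φ.source, q ∈ S → Function.Injective (A q) := fun q hq hqS =>
    (tangentSpace_eq_map_of_chart h1 h2 hK hq hqS).2.comp Subtype.val_injective
  refine ⟨_, (contDiffAt_adjoint_formula (hinj p hps hp)).comp p hA, ?_⟩
  filter_upwards [self_mem_nhdsWithin, mem_nhdsWithin_of_mem_nhds (Φ.open_source.mem_nhds hps)]
    with q hqS hq
  have hr : tangentSpace S q = LinearMap.range (A q : K →ₗ[ℝ] E) := by
    rw [(tangentSpace_eq_map_of_chart h1 h2 hK hq hqS).1]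
    ext x
    simp [A]
  simp only [Function.comp_apply, tangentProj]
  rw [← starProjection_range_eq (hinj q hq hqS)]
  congr 1

lemma IsEmbeddedSubmanifold.finrank_tangentSpace {k : ℕ} {S : Set E}
    (hS : IsEmbeddedSubmanifold k S) {p : E} (hp : p ∈ S) :
    Module.finrank ℝ (tangentSpace S p) = k := by
  obtain ⟨Φ, K, hk, hps, h1, h2, hK⟩ := hS p hp
  obtain ⟨h, hi⟩ := tangentSpace_eq_map_of_chart h1 h2 hK hps hp
  rw [h, ← hk]
  exact (Submodule.equivMapOfInjective _ hi K).finrank_eq.symm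

/-! ### Finiteness of the volume -/

/-- A compact embedded submanifold has finite volume: in slice charts it is a Lipschitz image of
a bounded piece of a `k`-dimensional linear subspace. -/
lemma volumeMeasure_univ_lt_top [MeasurableSpace E] [BorelSpace E] {k : ℕ} {S : Set E}
    (hS : IsEmbeddedSubmanifold k S) (hc : IsCompact S) : volumeMeasure k S univ < ⊤ := by
  rw [volumeMeasure, MeasureTheory.Measure.restrict_apply_univ]
  refine hc.measure_lt_top_of_nhdsWithin fun p hp => ?_
  obtain ⟨Φ, K, hk, hps, h1, h2, hK⟩ := hS p hp
  have hpt : Φ p ∈ Φ.target := Φ.map_source hps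
  obtain ⟨C, t, ht, hl⟩ := ((h2.contDiffAt (Φ.open_target.mem_nhds hpt)).of_le
    (by norm_cast : (1 : WithTop ℕ∞) ≤ ∞)).exists_lipschitzOnWith
  let B : Set E := (↑) '' Metric.closedBall (0 : K) (‖Φ p‖ + 1)
  have hB : (μH[(k : ℝ)] : MeasureTheory.Measure E) B < ⊤ := by
    rw [Isometry.hausdorffMeasure_image isometry_subtype_coe (by simp), ← hk]
    exact (isCompact_closedBall _ _).measure_lt_top
  refine ⟨Φ.symm '' (t ∩ B), ?_, ?_⟩
  · have hb : Metric.ball (0 : E) (‖Φ p‖ + 1) ∈ 𝓝 (Φ p) :=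
      Metric.isOpen_ball.mem_nhds (by simp)
    have hev : ∀ᶠ q in 𝓝 p, Φ q ∈ t ∩ Metric.ball (0 : E) (‖Φ p‖ + 1) :=
      (Φ.continuousAt hps) (inter_mem ht hb)
    filter_upwards [self_mem_nhdsWithin, mem_nhdsWithin_of_mem_nhds (Φ.open_source.mem_nhds hps),
      mem_nhdsWithin_of_mem_nhds hev] with q hqS hq hqt
    refine ⟨Φ q, ⟨hqt.1, ⟨Φ q, (hK q hq).1 hqS⟩, ?_, rfl⟩, Φ.left_inv hq⟩
    have := hqt.2
    simp only [Metric.mem_ball, dist_zero_right, Metric.mem_closedBall] at this ⊢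
    exact this.le
  · have hlt : (μH[(k : ℝ)] : MeasureTheory.Measure E) (Φ.symm '' (t ∩ B)) < ⊤ := by
      refine ((hl.mono inter_subset_left).hausdorffMeasure_image_le (by positivity)).trans_lt ?_
      exact ENNReal.mul_lt_top (by simp)
        ((MeasureTheory.measure_mono inter_subset_right).trans_lt hB)
    rw [MeasureTheory.Measure.euclideanHausdorffMeasure_def]
    exact ENNReal.mul_lt_top (by simp) hlt

/-! ### The unit sphere -/

omit [FiniteDimensional ℝ E] in
lemma mem_tangentSpace_sphere {p x : E} (hp : p ∈ Metric.sphere (0 : E) 1) :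
    x ∈ tangentSpace (Metric.sphere (0 : E) 1) p ↔ ⟪p, x⟫ = 0 := by
  have hp1 : ‖p‖ = 1 := by simpa using hp
  constructor
  · intro hx
    have hd : HasFDerivWithinAt (fun q : E => ‖q‖ ^ 2 - 1) (2 • innerSL ℝ p)
        (Metric.sphere (0 : E) 1) p :=
      ((hasStrictFDerivAt_norm_sq p).hasFDerivAt.sub_const 1).hasFDerivWithinAt
    have h := apply_eq_zero_of_mem_tangentSpace hd
      (fun q hq => by simp [mem_sphere_zero_iff_norm.1 hq]) hp hx
    simpa using h
  · intro hx
    rcases eq_or_ne x 0 with rfl | hx0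
    · exact zero_mem _
    -- the great circle through `p` with velocity `u = x / ‖x‖`
    have hxn : ‖x‖ ≠ 0 := norm_ne_zero_iff.2 hx0
    let u : E := ‖x‖⁻¹ • x
    have hu : ‖u‖ = 1 := by simp [u, norm_smul, hxn]
    have hpu : ⟪p, u⟫ = 0 := by simp [u, inner_smul_right, hx]
    have hd : HasDerivAt (fun t : ℝ => Real.cos t • p + Real.sin t • u) u 0 := by
      have h := ((Real.hasDerivAt_cos 0).smul_const p).fun_add
        ((Real.hasDerivAt_sin 0).smul_const u)
      simpa using h
    have hmem : ∀ t ∈ (univ : Set ℝ),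
        Real.cos t • p + Real.sin t • u ∈ Metric.sphere (0 : E) 1 := by
      intro t _
      have h2 : ‖Real.cos t • p + Real.sin t • u‖ ^ 2 = 1 := by
        rw [norm_add_sq_real]
        simp [norm_smul, inner_smul_left, inner_smul_right, hpu, hu, hp1]
      rw [mem_sphere_zero_iff_norm]
      nlinarith [norm_nonneg (Real.cos t • p + Real.sin t • u)]
    have h := apply_mem_tangentSpace (T := Metric.sphere (0 : E) 1) (x := (1 : ℝ))
      hd.hasFDerivAt.hasFDerivWithinAt hmem (by rw [tangentSpace_univ]; trivial)
    simp only [Real.cos_zero, one_smul, Real.sin_zero, zero_smul, add_zero,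
      ContinuousLinearMap.toSpanSingleton_apply] at h
    have h' := Submodule.smul_mem _ ‖x‖ h
    rwa [smul_inv_smul₀ hxn] at h'

lemma tangentProj_sphere {p : E} (hp : p ∈ Metric.sphere (0 : E) 1) (x : E) :
    tangentProj (Metric.sphere (0 : E) 1) p x = x - ⟪p, x⟫ • p := by
  have hp1 : ‖p‖ = 1 := by simpa using hp
  rw [tangentProj]
  apply Submodule.eq_starProjection_of_mem_of_inner_eq_zero
  · rw [mem_tangentSpace_sphere hp]
    simp [inner_sub_right, inner_smul_right, hp1]
  · intro w hw
    rw [mem_tangentSpace_sphere hp] at hw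
    simp [inner_smul_left, hw]

lemma fderivWithin_tangentExt_sphere {q u : E} (z : E) (hq : q ∈ Metric.sphere (0 : E) 1)
    (hu : ⟪q, u⟫ = 0) :
    fderivWithin ℝ (tangentExt (Metric.sphere (0 : E) 1) z) (Metric.sphere (0 : E) 1) q u
      = -(⟪z, q⟫ • u + ⟪z, u⟫ • q) := by
  have hd := (((innerSL ℝ z).hasFDerivAt (x := q)).smul (hasFDerivAt_id q)).const_sub z
  have hd' := hd.hasFDerivWithinAt.congr (s := Metric.sphere (0 : E) 1)
    (f₁ := tangentExt (Metric.sphere (0 : E) 1) z) (fun r hr => by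
      simp [tangentExt, tangentProj_sphere hr, real_inner_comm])
    (by simp [tangentExt, tangentProj_sphere hq, real_inner_comm])
  rw [fderivWithin_eq_of_mem hd' ((mem_tangentSpace_sphere hq).2 hu)]
  simp

lemma covDeriv_tangentExt_sphere {q u : E} (z : E) (hq : q ∈ Metric.sphere (0 : E) 1)
    (hu : ⟪q, u⟫ = 0) :
    covDeriv (Metric.sphere (0 : E) 1) (Metric.sphere (0 : E) 1)
      (tangentExt (Metric.sphere (0 : E) 1) z) q u = -(⟪z, q⟫ • u) := by
  have hq1 : ‖q‖ = 1 := by simpa using hq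
  rw [covDeriv, fderivWithin_tangentExt_sphere z hq hu, tangentProj_sphere hq]
  simp [inner_add_right, inner_smul_right, hu, hq1]

lemma covDeriv_covDeriv_tangentExt_sphere {p x y z : E} (hp : p ∈ Metric.sphere (0 : E) 1)
    (hx : ⟪p, x⟫ = 0) (hy : ⟪p, y⟫ = 0) (hz : ⟪p, z⟫ = 0) :
    covDeriv (Metric.sphere (0 : E) 1) (Metric.sphere (0 : E) 1)
      (fun q => covDeriv (Metric.sphere (0 : E) 1) (Metric.sphere (0 : E) 1)
        (tangentExt (Metric.sphere (0 : E) 1) z) q (tangentExt (Metric.sphere (0 : E) 1) x q))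
      p y = -(⟪z, y⟫ • x) := by
  have hp1 : ‖p‖ = 1 := by simpa using hp
  have hd := (((innerSL ℝ z).hasFDerivAt (x := p)).smul
    ((((innerSL ℝ x).hasFDerivAt (x := p)).smul (hasFDerivAt_id p)).const_sub x)).neg
  have hval : ∀ q ∈ Metric.sphere (0 : E) 1,
      covDeriv (Metric.sphere (0 : E) 1) (Metric.sphere (0 : E) 1)
        (tangentExt (Metric.sphere (0 : E) 1) z) q (tangentExt (Metric.sphere (0 : E) 1) x q)
      = -(⟪z, q⟫ • (x - ⟪x, q⟫ • q)) := by
    intro q hq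
    have hq1 : ‖q‖ = 1 := by simpa using hq
    have hX : tangentExt (Metric.sphere (0 : E) 1) x q = x - ⟪x, q⟫ • q := by
      rw [tangentExt, tangentProj_sphere hq, real_inner_comm]
    rw [hX, covDeriv_tangentExt_sphere z hq]
    simp [inner_sub_right, inner_smul_right, hq1, real_inner_comm]
  have hd' := hd.hasFDerivWithinAt.congr (s := Metric.sphere (0 : E) 1)
    (fun q hq => by simpa using hval q hq) (by simpa using hval p hp)
  rw [covDeriv, fderivWithin_eq_of_mem hd' ((mem_tangentSpace_sphere hp).2 hy),
    tangentProj_sphere hp]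
  simp [inner_smul_right, hx, real_inner_comm p, hz]

/-- The unit sphere has constant curvature `1` (with the sign convention of `curvatureField`). -/
lemma curvature_sphere {p x y z : E} (hp : p ∈ Metric.sphere (0 : E) 1)
    (hx : ⟪p, x⟫ = 0) (hy : ⟪p, y⟫ = 0) (hz : ⟪p, z⟫ = 0) :
    curvature (Metric.sphere (0 : E) 1) p x y z = ⟪z, x⟫ • y - ⟪z, y⟫ • x := by
  have hval : ∀ w, ⟪p, w⟫ = 0 → tangentExt (Metric.sphere (0 : E) 1) w p = w := by
    intro w hw
    rw [tangentExt, tangentProj_sphere hp, hw, zero_smul, sub_zero]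
  have hL : VectorField.lieBracketWithin ℝ (tangentExt (Metric.sphere (0 : E) 1) x)
      (tangentExt (Metric.sphere (0 : E) 1) y) (Metric.sphere (0 : E) 1) p = 0 := by
    rw [VectorField.lieBracketWithin, hval x hx, hval y hy,
      fderivWithin_tangentExt_sphere _ hp hx, fderivWithin_tangentExt_sphere _ hp hy]
    simp [real_inner_comm p, hx, hy, real_inner_comm x y]
  rw [curvature, curvatureField, hL, hval x hx, hval y hy,
    covDeriv_covDeriv_tangentExt_sphere hp hx hy hz,
    covDeriv_covDeriv_tangentExt_sphere hp hy hx hz, covDeriv]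
  simp only [map_zero, add_zero]
  abel

/-- The gradient on the sphere of a linear function is the tangential part of the constant
vector field that represents it. -/
lemma grad_sphere_inner (p v : E) :
    grad (Metric.sphere (0 : E) 1) (fun x => ⟪v, x⟫) p
      = tangentProj (Metric.sphere (0 : E) 1) p v := by
  rw [grad, LinearIsometryEquiv.symm_apply_eq]
  ext w
  have hd : HasFDerivWithinAt (fun x => ⟪v, x⟫) (innerSL ℝ v) (Metric.sphere (0 : E) 1) p :=
    (innerSL ℝ v).hasFDerivWithinAt
  rw [ContinuousLinearMap.comp_apply, fderivWithin_eq_of_mem hd tangentProj_mem,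
    InnerProductSpace.toDual_apply_apply, innerSL_apply_apply, tangentProj,
    Submodule.inner_starProjection_left_eq_right]

/-- The normal projection of a subset of the sphere is the orthogonal projection onto the
complement of the position vector and of the tangent space. -/
lemma normalProj_sphere {S : Set E} (hS : S ⊆ Metric.sphere (0 : E) 1) {p : E} (hp : p ∈ S)
    (x : E) :
    normalProj (Metric.sphere (0 : E) 1) S p x = x - ⟪p, x⟫ • p - tangentProj S p x := by
  have hp1 : ‖p‖ = 1 := by simpa using hS hp
  have hT : ∀ w ∈ tangentSpace S p, ⟪p, w⟫ = 0 := fun w hw =>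
    (mem_tangentSpace_sphere (hS hp)).1 (tangentSpace_mono hS p hw)
  rw [normalProj]
  apply Submodule.eq_starProjection_of_mem_of_inner_eq_zero
  · refine ⟨?_, ?_⟩
    · rw [SetLike.mem_coe, mem_tangentSpace_sphere (hS hp)]
      simp [inner_sub_right, inner_smul_right, hp1, hT _ tangentProj_mem]
    · rw [SetLike.mem_coe, Submodule.mem_orthogonal']
      intro w hw
      have := Submodule.starProjection_inner_eq_zero (K := tangentSpace S p) x w hw
      rw [sub_right_comm, inner_sub_left, tangentProj, this, inner_smul_left, hT w hw]
      simp
  · rintro w ⟨hw1, hw2⟩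
    rw [SetLike.mem_coe, mem_tangentSpace_sphere (hS hp)] at hw1
    rw [SetLike.mem_coe, Submodule.mem_orthogonal] at hw2
    have h2 := hw2 (tangentProj S p x) tangentProj_mem
    rw [show x - (x - ⟪p, x⟫ • p - tangentProj S p x) = ⟪p, x⟫ • p + tangentProj S p x by abel,
      inner_add_left, inner_smul_left, hw1, h2]
    simp

lemma normalPart_grad_sphere (S : Set E) (p v : E) :
    normalPart (Metric.sphere (0 : E) 1) S (grad (Metric.sphere (0 : E) 1) (fun x => ⟪v, x⟫)) p
      = normalProj (Metric.sphere (0 : E) 1) S p v := by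
  rw [normalPart, grad_sphere_inner, tangentProj, normalProj]
  have h := Submodule.starProjection_comp_starProjection_of_le
    (inf_le_left : normalSpace (Metric.sphere (0 : E) 1) S p ≤ _)
  exact DFunLike.congr_fun h v

/-! ### The normal connection and the second fundamental form -/

lemma normalProj_tangentProj {M S : Set E} {p : E} (x : E) :
    normalProj M S p (tangentProj S p x) = 0 := by
  rw [normalProj, Submodule.starProjection_apply_eq_zero_iff, Submodule.mem_orthogonal]
  intro u hu
  rw [real_inner_comm]
  exact (Submodule.mem_orthogonal _ _).1 hu.2 _ tangentProj_mem

lemma normalProj_tangentProj_ambient {M S : Set E} {p : E} (x : E) :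
    normalProj M S p (tangentProj M p x) = normalProj M S p x :=
  DFunLike.congr_fun (Submodule.starProjection_comp_starProjection_of_le
    (inf_le_left : normalSpace M S p ≤ tangentSpace M p)) x

/-- Writing `P` for the tangential and `N` for the normal projection, differentiation of `P² = P`
gives `(D_x P) P + P (D_x P) = D_x P`, and `N P = 0`. Hence the normal part of `(D_x P) y` depends
only on the tangential part of `y`. -/
lemma normalProj_fderivWithin_tangentProj {M S : Set E} {p x : E}
    (hP : DifferentiableWithinAt ℝ (tangentProj S) S p) (hx : x ∈ tangentSpace S p) (y : E) :
    normalProj M S p (fderivWithin ℝ (tangentProj S) S p x (tangentProj S p y))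
      = normalProj M S p (fderivWithin ℝ (tangentProj S) S p x y) := by
  have h1 : HasFDerivWithinAt (fun q => tangentProj S q y) _ S p :=
    hP.hasFDerivWithinAt.clm_apply (hasFDerivWithinAt_const y p S)
  have h2 : HasFDerivWithinAt (fun q => tangentProj S q y) _ S p :=
    (hP.hasFDerivWithinAt.clm_apply h1).congr
      (fun q _ => (tangentProj_eq tangentProj_mem).symm) (tangentProj_eq tangentProj_mem).symm
  have h := (fderivWithin_eq_of_mem h1 hx).symm.trans (fderivWithin_eq_of_mem h2 hx)
  have h' := congrArg (normalProj M S p) h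
  simpa [normalProj_tangentProj] using h'.symm

lemma secondFundamentalForm_eq {M S : Set E} {p x : E}
    (hP : DifferentiableWithinAt ℝ (tangentProj S) S p) (hx : x ∈ tangentSpace S p) (y : E) :
    secondFundamentalForm M S p x y
      = normalProj M S p (fderivWithin ℝ (tangentProj S) S p x y) := by
  have h1 : HasFDerivWithinAt (tangentExt S y) _ S p :=
    hP.hasFDerivWithinAt.clm_apply (hasFDerivWithinAt_const y p S)
  rw [secondFundamentalForm, normalCovDeriv, covDeriv, normalProj_tangentProj_ambient,
    fderivWithin_eq_of_mem h1 hx]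
  simp

/-- `∇^⊥_x (v^⊥) = -N (D_x P) v` for a constant vector `v`, which is `-A(x, v^T)` by
`secondFundamentalForm_eq` and `normalProj_fderivWithin_tangentProj`. -/
lemma normalCovDeriv_normalPart_grad_sphere {S : Set E} (hS : S ⊆ Metric.sphere (0 : E) 1)
    {p x : E} (hp : p ∈ S) (hP : DifferentiableWithinAt ℝ (tangentProj S) S p)
    (hx : x ∈ tangentSpace S p) (v : E) :
    normalCovDeriv (Metric.sphere (0 : E) 1) S
      (normalPart (Metric.sphere (0 : E) 1) S
        (grad (Metric.sphere (0 : E) 1) (fun x => ⟪v, x⟫))) p x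
      = -normalProj (Metric.sphere (0 : E) 1) S p (fderivWithin ℝ (tangentProj S) S p x v) := by
  have hp1 : ‖p‖ = 1 := by simpa using hS hp
  have hval : ∀ q ∈ S, normalPart (Metric.sphere (0 : E) 1) S
      (grad (Metric.sphere (0 : E) 1) (fun x => ⟪v, x⟫)) q
      = v - ⟪v, q⟫ • q - tangentProj S q v := by
    intro q hq
    rw [normalPart_grad_sphere, normalProj_sphere hS hq, real_inner_comm]
  have hd := ((((innerSL ℝ v).hasFDerivAt (x := p)).smul
    (hasFDerivAt_id p)).const_sub v).hasFDerivWithinAt (s := S) |>.sub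
    (hP.hasFDerivWithinAt.clm_apply (hasFDerivWithinAt_const v p S))
  have hd' := hd.congr (fun q hq => by simpa using hval q hq) (by simpa using hval p hp)
  have hNx : normalProj (Metric.sphere (0 : E) 1) S p x = 0 := by
    rw [← tangentProj_eq hx, normalProj_tangentProj]
  have hNp : normalProj (Metric.sphere (0 : E) 1) S p p = 0 := by
    have h0 : tangentProj S p p = 0 := by
      rw [tangentProj, Submodule.starProjection_apply_eq_zero_iff, Submodule.mem_orthogonal']
      intro u hu
      exact (mem_tangentSpace_sphere (hS hp)).1 (tangentSpace_mono hS p hu)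
    rw [normalProj_sphere hS hp, h0]
    simp [hp1]
  rw [normalCovDeriv, covDeriv, normalProj_tangentProj_ambient, fderivWithin_eq_of_mem hd' hx]
  simp [hNx, hNp]

/-- The second variation density of `v^⊥`, in terms of the derivative of the field of tangential
projections. -/
lemma secondVariationDensity_sphere {S : Set E} (hS : S ⊆ Metric.sphere (0 : E) 1) {p : E}
    (hp : p ∈ S) (hP : DifferentiableWithinAt ℝ (tangentProj S) S p) (v : E) :
    secondVariationDensity (Metric.sphere (0 : E) 1) S
      (normalPart (Metric.sphere (0 : E) 1) S
        (grad (Metric.sphere (0 : E) 1) (fun x => ⟪v, x⟫))) p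
      = ∑ i, ‖normalProj (Metric.sphere (0 : E) 1) S p (fderivWithin ℝ (tangentProj S) S p
          (stdOrthonormalBasis ℝ (tangentSpace S p) i) v)‖ ^ 2
        - Module.finrank ℝ (tangentSpace S p) * ‖normalProj (Metric.sphere (0 : E) 1) S p v‖ ^ 2
        - ∑ i, ∑ j, ⟪normalProj (Metric.sphere (0 : E) 1) S p (fderivWithin ℝ (tangentProj S) S p
            (stdOrthonormalBasis ℝ (tangentSpace S p) i)
            (stdOrthonormalBasis ℝ (tangentSpace S p) j)),
          normalProj (Metric.sphere (0 : E) 1) S p v⟫ ^ 2 := by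
  set e := stdOrthonormalBasis ℝ (tangentSpace S p) with he
  have hN : normalProj (Metric.sphere (0 : E) 1) S p v
      ∈ normalSpace (Metric.sphere (0 : E) 1) S p := Submodule.starProjection_apply_mem _ _
  have hcurv : ∀ i, ⟪curvature (Metric.sphere (0 : E) 1) p
      (normalProj (Metric.sphere (0 : E) 1) S p v) (e i)
      (normalProj (Metric.sphere (0 : E) 1) S p v), (e i : E)⟫
      = ‖normalProj (Metric.sphere (0 : E) 1) S p v‖ ^ 2 := by
    intro i
    have h1 := (mem_tangentSpace_sphere (hS hp)).1 hN.1
    have h2 := (mem_tangentSpace_sphere (hS hp)).1 (tangentSpace_mono hS p (e i).2)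
    have h3 := (Submodule.mem_orthogonal' _ _).1 hN.2 _ (e i).2
    have h4 : ‖(e i : E)‖ = 1 := e.norm_eq_one i
    rw [curvature_sphere (hS hp) h1 h2 h1, h3, zero_smul, sub_zero, inner_smul_left,
      real_inner_self_eq_norm_sq, real_inner_self_eq_norm_sq, h4]
    simp
  simp only [secondVariationDensity, normalPart_grad_sphere, ← he, hcurv]
  congr 1
  · congr 1
    · refine Finset.sum_congr rfl fun i _ => ?_
      rw [normalCovDeriv_normalPart_grad_sphere hS hp hP (e i).2, norm_neg]
    · simp
  · refine Finset.sum_congr rfl fun i _ => Finset.sum_congr rfl fun j _ => ?_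
    rw [secondFundamentalForm_eq hP (e i).2]

/-! ### The pointwise trace -/

/-- The Hilbert–Schmidt norm of an operator and of its adjoint agree. -/
lemma sum_norm_sq_eq_sum_norm_sq_adjoint {ι κ : Type*} [Fintype ι] [Fintype κ]
    (b : OrthonormalBasis ι ℝ E) (c : OrthonormalBasis κ ℝ F) (A : E →L[ℝ] F) :
    ∑ i, ‖A (b i)‖ ^ 2 = ∑ j, ‖A.adjoint (c j)‖ ^ 2 := by
  simp_rw [← c.sum_sq_inner_right, ← b.sum_sq_inner_left, ContinuousLinearMap.adjoint_inner_left]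
  exact Finset.sum_comm

/-- The sum of `‖L e‖²` over an orthonormal basis of a subspace, computed in an orthonormal basis
of the whole space. -/
lemma sum_norm_sq_orthonormalBasis_subspace {ι κ : Type*} [Fintype ι] [Fintype κ]
    {W : Submodule ℝ E} (e : OrthonormalBasis ι ℝ W) (b : OrthonormalBasis κ ℝ E)
    (L : E →L[ℝ] F) :
    ∑ i, ‖L (e i)‖ ^ 2 = ∑ a, ‖L (W.starProjection (b a))‖ ^ 2 := by
  have h1 := sum_norm_sq_eq_sum_norm_sq_adjoint e (stdOrthonormalBasis ℝ F) (L ∘L W.subtypeL)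
  have h2 := sum_norm_sq_eq_sum_norm_sq_adjoint b (stdOrthonormalBasis ℝ F)
    (L ∘L W.starProjection)
  simp only [ContinuousLinearMap.comp_apply, Submodule.subtypeL_apply] at h1 h2
  rw [h1, h2]
  refine Finset.sum_congr rfl fun j _ => ?_
  have hs : W.starProjection.adjoint = W.starProjection :=
    ContinuousLinearMap.isSelfAdjoint_iff'.1 (isSelfAdjoint_starProjection W)
  rw [ContinuousLinearMap.adjoint_comp, ContinuousLinearMap.adjoint_comp, hs,
    Submodule.adjoint_subtypeL]
  rfl

lemma norm_sq_starProjection (W : Submodule ℝ E) (x : E) :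
    ‖W.starProjection x‖ ^ 2 = ⟪W.starProjection x, x⟫ := by
  rw [← real_inner_self_eq_norm_sq, ← Submodule.inner_starProjection_left_eq_right,
    Submodule.starProjection_eq_self_iff.2 (Submodule.starProjection_apply_mem _ _)]

/-- The pointwise trace identity. The gradient term and the second fundamental form term cancel,
as `∇^⊥_x (v^⊥) = -A(x, v^T)`; the curvature term counts the dimension of the normal space. -/
lemma sum_secondVariationDensity_sphere {S : Set E} (hS : S ⊆ Metric.sphere (0 : E) 1) {p : E}
    (hp : p ∈ S) (hP : DifferentiableWithinAt ℝ (tangentProj S) S p)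
    {κ : Type*} [Fintype κ] (v : OrthonormalBasis κ ℝ E) :
    ∑ α, secondVariationDensity (Metric.sphere (0 : E) 1) S
      (normalPart (Metric.sphere (0 : E) 1) S
        (grad (Metric.sphere (0 : E) 1) (fun x => ⟪v α, x⟫))) p
      = -(Module.finrank ℝ (tangentSpace S p) : ℝ)
        * (Fintype.card κ - 1 - Module.finrank ℝ (tangentSpace S p)) := by
  have hp1 : ‖p‖ = 1 := by simpa using hS hp
  simp only [secondVariationDensity_sphere hS hp hP, Finset.sum_sub_distrib, ← Finset.mul_sum]
  set e := stdOrthonormalBasis ℝ (tangentSpace S p)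
  set N := normalProj (Metric.sphere (0 : E) 1) S p with hNdef
  set D := fderivWithin ℝ (tangentProj S) S p
  have hgrad : ∑ α, ∑ i, ‖N (D (e i) (v α))‖ ^ 2 = ∑ i, ∑ j, ‖N (D (e i) (e j))‖ ^ 2 := by
    rw [Finset.sum_comm]
    refine Finset.sum_congr rfl fun i _ => ?_
    refine Eq.trans ?_ (sum_norm_sq_orthonormalBasis_subspace e v (N ∘L D (e i))).symm
    refine Finset.sum_congr rfl fun α _ => ?_
    rw [ContinuousLinearMap.comp_apply]
    exact congrArg (fun w => ‖w‖ ^ 2)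
      (normalProj_fderivWithin_tangentProj hP (e i).2 (v α)).symm
  have hII : ∑ α, ∑ i, ∑ j, ⟪N (D (e i) (e j)), N (v α)⟫ ^ 2
      = ∑ i, ∑ j, ‖N (D (e i) (e j))‖ ^ 2 := by
    rw [Finset.sum_comm]
    refine Finset.sum_congr rfl fun i _ => ?_
    rw [Finset.sum_comm]
    refine Finset.sum_congr rfl fun j _ => ?_
    rw [← v.sum_sq_inner_left]
    refine Finset.sum_congr rfl fun α _ => ?_
    rw [hNdef, normalProj, ← Submodule.inner_starProjection_left_eq_right,
      Submodule.starProjection_eq_self_iff.2 (Submodule.starProjection_apply_mem _ _)]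
  have hdim : ∑ α, ‖N (v α)‖ ^ 2 = Fintype.card κ - 1 - Module.finrank ℝ (tangentSpace S p) := by
    have h1 : ∀ α, ‖N (v α)‖ ^ 2 = 1 - ⟪p, v α⟫ ^ 2 - ‖tangentProj S p (v α)‖ ^ 2 := by
      intro α
      have a1 : ‖N (v α)‖ ^ 2 = ⟪N (v α), v α⟫ := by
        exact norm_sq_starProjection _ _
      have a2 : ‖tangentProj S p (v α)‖ ^ 2 = ⟪tangentProj S p (v α), v α⟫ := by
        exact norm_sq_starProjection _ _
      rw [a1, a2, hNdef, normalProj_sphere hS hp, inner_sub_left, inner_sub_left, inner_smul_left,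
        real_inner_self_eq_norm_sq, v.norm_eq_one]
      simp [sq]
    have h2 : ∑ α, ‖tangentProj S p (v α)‖ ^ 2 = Module.finrank ℝ (tangentSpace S p) := by
      have h := sum_norm_sq_orthonormalBasis_subspace e v (ContinuousLinearMap.id ℝ E)
      have he : ∀ i, ‖(e i : E)‖ = 1 := fun i => e.norm_eq_one i
      refine h.symm.trans ?_
      simp [he]
    simp only [h1, Finset.sum_sub_distrib, h2, v.sum_sq_inner_left, hp1]
    simp
  rw [hgrad, hII, hdim]
  ring

/-! ### Continuity of the second variation density -/

/-- The second variation density of `v^⊥` as a polynomial expression in the tangential projection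
`P`, the normal projection `N` and the derivative `D` of the tangential projection, evaluated in a
fixed orthonormal basis of the ambient space. -/
noncomputable def densityExpr {κ : Type*} [Fintype κ] (b : OrthonormalBasis κ ℝ E) (k : ℕ) (v : E)
    (P N : E →L[ℝ] E) (D : E →L[ℝ] E →L[ℝ] E) : ℝ :=
  ∑ a, ‖N (D (P (b a)) v)‖ ^ 2 - k * ‖N v‖ ^ 2
    - ∑ a, ∑ c, ⟪N (D (P (b a)) (P (b c))), N v⟫ ^ 2

lemma secondVariationDensity_eq_densityExpr {S : Set E} (hS : S ⊆ Metric.sphere (0 : E) 1) {p : E}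
    (hp : p ∈ S) (hP : DifferentiableWithinAt ℝ (tangentProj S) S p)
    {κ : Type*} [Fintype κ] (b : OrthonormalBasis κ ℝ E) (v : E) :
    secondVariationDensity (Metric.sphere (0 : E) 1) S
      (normalPart (Metric.sphere (0 : E) 1) S
        (grad (Metric.sphere (0 : E) 1) (fun x => ⟪v, x⟫))) p
      = densityExpr b (Module.finrank ℝ (tangentSpace S p)) v (tangentProj S p)
        (normalProj (Metric.sphere (0 : E) 1) S p) (fderivWithin ℝ (tangentProj S) S p) := by
  rw [secondVariationDensity_sphere hS hp hP, densityExpr]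
  set e := stdOrthonormalBasis ℝ (tangentSpace S p)
  set N := normalProj (Metric.sphere (0 : E) 1) S p
  set D := fderivWithin ℝ (tangentProj S) S p
  have hsq : ∀ x : ℝ, x ^ 2 = ‖x‖ ^ 2 := fun x => by simp
  have h1 := sum_norm_sq_orthonormalBasis_subspace e b (N ∘L D.flip v)
  have h2 : ∀ x, ∑ j, ⟪N (D x (e j)), N v⟫ ^ 2
      = ∑ c, ⟪N (D x (tangentProj S p (b c))), N v⟫ ^ 2 := by
    intro x
    have := sum_norm_sq_orthonormalBasis_subspace e b (innerSL ℝ (N v) ∘L N ∘L D x)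
    simp only [ContinuousLinearMap.comp_apply, innerSL_apply_apply, ← hsq] at this
    simpa only [real_inner_comm, tangentProj] using this
  have h3 : ∀ y, ∑ i, ⟪N (D (e i) y), N v⟫ ^ 2
      = ∑ a, ⟪N (D (tangentProj S p (b a)) y), N v⟫ ^ 2 := by
    intro y
    have := sum_norm_sq_orthonormalBasis_subspace e b (innerSL ℝ (N v) ∘L N ∘L D.flip y)
    simp only [ContinuousLinearMap.comp_apply, innerSL_apply_apply, ← hsq,
      ContinuousLinearMap.flip_apply] at this
    simpa only [real_inner_comm, tangentProj] using this
  simp only [ContinuousLinearMap.comp_apply, ContinuousLinearMap.flip_apply] at h1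
  simp only [h2]
  rw [h1, Finset.sum_comm]
  simp only [h3]
  rw [Finset.sum_comm]
  rfl

omit [FiniteDimensional ℝ E] in
lemma continuous_densityExpr {κ : Type*} [Fintype κ] (b : OrthonormalBasis κ ℝ E) (k : ℕ) (v : E) :
    Continuous fun t : (E →L[ℝ] E) × (E →L[ℝ] E) × (E →L[ℝ] E →L[ℝ] E) =>
      densityExpr b k v t.1 t.2.1 t.2.2 := by
  unfold densityExpr
  fun_prop

lemma IsEmbeddedSubmanifold.differentiableWithinAt_tangentProj {k : ℕ} {S : Set E}
    (hS : IsEmbeddedSubmanifold k S) {p : E} (hp : p ∈ S) :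
    DifferentiableWithinAt ℝ (tangentProj S) S p := by
  obtain ⟨Q, hQ, hev⟩ := hS.exists_contDiffAt_tangentProj hp
  exact (hQ.differentiableAt (by simp)).differentiableWithinAt.congr_of_eventuallyEq hev
    (hev.self_of_nhdsWithin hp)

omit [FiniteDimensional ℝ E] in
lemma continuous_innerSL_smulRight_self :
    Continuous fun q : E => (innerSL ℝ q).smulRight q :=
  (ContinuousLinearMap.smulRightL ℝ E E).continuous₂.comp
    ((innerSL ℝ).continuous.prodMk continuous_id)

/-- The second variation density of `v^⊥` is continuous along the submanifold: the tangential
projection and its derivative in tangential directions agree locally with those of a `C¹`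
function on the ambient space. -/
lemma continuousOn_secondVariationDensity_sphere {k : ℕ} {S : Set E}
    (hS : S ⊆ Metric.sphere (0 : E) 1) (hk : IsEmbeddedSubmanifold k S) (v : E) :
    ContinuousOn (secondVariationDensity (Metric.sphere (0 : E) 1) S
      (normalPart (Metric.sphere (0 : E) 1) S
        (grad (Metric.sphere (0 : E) 1) (fun x => ⟪v, x⟫)))) S := by
  intro p hp
  obtain ⟨Q, hQ, hev⟩ := hk.exists_contDiffAt_tangentProj hp
  let b := stdOrthonormalBasis ℝ E
  let N : E → E →L[ℝ] E := fun q =>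
    ContinuousLinearMap.id ℝ E - (innerSL ℝ q).smulRight q - Q q
  have hQd : ∀ᶠ q in 𝓝 p, DifferentiableAt ℝ Q q :=
    (hQ.eventually (by simp)).mono fun q hq => hq.differentiableAt (by simp)
  have heq : ∀ᶠ q in 𝓝[S] p, secondVariationDensity (Metric.sphere (0 : E) 1) S
      (normalPart (Metric.sphere (0 : E) 1) S
        (grad (Metric.sphere (0 : E) 1) (fun x => ⟪v, x⟫))) q
      = densityExpr b k v (Q q) (N q) (fderiv ℝ Q q) := by
    filter_upwards [self_mem_nhdsWithin, eventually_eventually_nhdsWithin.2 hev,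
      mem_nhdsWithin_of_mem_nhds hQd] with q hq hevq hQq
    have hqQ : tangentProj S q = Q q := hevq.self_of_nhdsWithin hq
    have hqN : normalProj (Metric.sphere (0 : E) 1) S q = N q := by
      ext x
      rw [normalProj_sphere hS hq, hqQ]
      simp [N]
    have hqD : ∀ x, fderivWithin ℝ (tangentProj S) S q (Q q x) = fderiv ℝ Q q (Q q x) := by
      intro x
      exact fderivWithin_eq_of_mem
        (hQq.hasFDerivAt.hasFDerivWithinAt.congr_of_eventuallyEq hevq hqQ)
        (hqQ ▸ tangentProj_mem)
    rw [secondVariationDensity_eq_densityExpr hS hq (hk.differentiableWithinAt_tangentProj hq) b,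
      hk.finrank_tangentSpace hq, hqQ, hqN]
    simp only [densityExpr, hqD]
  have hcQ : ContinuousAt Q p := hQ.continuousAt
  have hcN : ContinuousAt N p := by
    exact (continuousAt_const.sub continuous_innerSL_smulRight_self.continuousAt).sub hcQ
  have hcD : ContinuousAt (fderiv ℝ Q) p := (hQ.fderiv_right (m := 0) (by simp)).continuousAt
  have h3 : ContinuousAt (fun q => (Q q, N q, fderiv ℝ Q q)) p := hcQ.prodMk (hcN.prodMk hcD)
  have hc : ContinuousAt (fun q => densityExpr b k v (Q q) (N q) (fderiv ℝ Q q)) p :=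
    ContinuousAt.comp (f := fun q => (Q q, N q, fderiv ℝ Q q))
      (g := fun t : (E →L[ℝ] E) × (E →L[ℝ] E) × (E →L[ℝ] E →L[ℝ] E) =>
        densityExpr b k v t.1 t.2.1 t.2.2) (continuous_densityExpr b k v).continuousAt h3
  exact hc.continuousWithinAt.congr_of_eventuallyEq heq (heq.self_of_nhdsWithin hp)

end SubmanifoldGeometry

open SubmanifoldGeometry in
theorem theorem4p1 (n k : ℕ) (S : Set (EuclideanSpace ℝ (Fin (n + 1))))
    (hS : SubmanifoldGeometry.IsClosedSubmanifold k S (SubmanifoldGeometry.roundSphere n))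
    (v : OrthonormalBasis (Fin (n + 1)) ℝ (EuclideanSpace ℝ (Fin (n + 1)))) :
    -- the pointwise trace
    (∀ p ∈ S, SubmanifoldGeometry.traceDensity n S v p = -(k : ℝ) * ((n : ℝ) - (k : ℝ))) ∧
    -- the volume is finite and the integrals that define the `Q(V_α^⊥, V_α^⊥)` converge
    SubmanifoldGeometry.volumeMeasure k S Set.univ < ⊤ ∧
    (∀ α, MeasureTheory.Integrable
      (SubmanifoldGeometry.secondVariationDensity (SubmanifoldGeometry.roundSphere n) S
        (SubmanifoldGeometry.normalPart (SubmanifoldGeometry.roundSphere n) S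
          (SubmanifoldGeometry.sphereField n (v α))))
      (SubmanifoldGeometry.volumeMeasure k S)) ∧
    -- the integrated trace
    SubmanifoldGeometry.traceSecondVariation n k S v
      = ∫ p, SubmanifoldGeometry.traceDensity n S v p
          ∂(SubmanifoldGeometry.volumeMeasure k S) ∧
    ∫ p, SubmanifoldGeometry.traceDensity n S v p ∂(SubmanifoldGeometry.volumeMeasure k S)
      = -(k : ℝ) * ((n : ℝ) - (k : ℝ)) * (SubmanifoldGeometry.volumeMeasure k S).real Set.univ := by
  have hsub : S ⊆ Metric.sphere (0 : EuclideanSpace ℝ (Fin (n + 1))) 1 := hS.subset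
  have hemb := hS.isEmbeddedSubmanifold
  have htrace : ∀ p ∈ S, traceDensity n S v p = -(k : ℝ) * ((n : ℝ) - (k : ℝ)) := by
    intro p hp
    have h := sum_secondVariationDensity_sphere hsub hp
      (hemb.differentiableWithinAt_tangentProj hp) v
    rw [hemb.finrank_tangentSpace hp] at h
    rw [Fintype.card_fin, Nat.cast_add_one, add_sub_cancel_right] at h
    exact h
  have hfin : volumeMeasure k S Set.univ < ⊤ := volumeMeasure_univ_lt_top hemb hS.isCompact
  have hfin' : (μHE[k] : MeasureTheory.Measure (EuclideanSpace ℝ (Fin (n + 1)))) S ≠ ⊤ := by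
    rw [volumeMeasure, MeasureTheory.Measure.restrict_apply_univ] at hfin
    exact hfin.ne
  have hint : ∀ α, MeasureTheory.Integrable
      (secondVariationDensity (roundSphere n) S
        (normalPart (roundSphere n) S (sphereField n (v α)))) (volumeMeasure k S) := fun α =>
    (continuousOn_secondVariationDensity_sphere hsub hemb (v α)).integrableOn_of_subset_isCompact
      hS.isCompact hS.isCompact.measurableSet Set.Subset.rfl hfin'
  refine ⟨htrace, hfin, hint, ?_, ?_⟩
  · simp only [traceSecondVariation, secondVariation, traceDensity]
    exact (MeasureTheory.integral_finsetSum _ fun α _ => hint α).symm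
  · rw [volumeMeasure, MeasureTheory.setIntegral_congr_fun hS.isCompact.measurableSet htrace]
    simp [mul_comm]
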